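/- In the game $\langle G,k,s\rangle$ on a finite graph $G$, each vertex (sage) receives a hat of one of $k$ colours, sees only the hats of its neighbours, and simultaneously with the others makes $s$ guesses of its own hat colour according to a deterministic strategy fixed in advance; the game is winning if some strategy guarantees, for every hat placement, that at least one sage has a correct guess. Let $\mathrm{HG}_s(G)$ be the maximal $k$ for which $\langle G,k,s\rangle$ is winning, and for a class $\mathcal C$ of finite graphs let $\mathrm{HG}_s(\mathcal C)=\sup\{\mathrm{HG}_s(G):G\in\mathcal C\}$. For $n\ge 1$, the petal $Pe_n$ is obtained from the path $P_n$ on $n$ vertices by adding a new vertex, called the stem, adjacent to every vertex of $P_n$. A royal petunia is a graph obtained by starting from a petal and repeatedly (zero or more times) adding a new petal by gluing the stem of the new petal to an arbitrary vertex of the graph constructed so far. Let $\mathcal{RP}$ be the class of royal petunias and $\mathcal{OP}$ the class of finite outerplanar graphs (graphs with a crossing-free drawing in the plane in which every vertex lies on the boundary of the outer face). **Corollary.** Let $s\ge 1$ be an integer. Then $\mathrm{HG}_s(\mathcal{RP})=4s(s+1)-2$. More precisely: a) $\mathrm{HG}_s(G)<4s(s+1)-1$ for every royal petunia $G$; b)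 there is an $N=N(s)$ such that $\mathrm{HG}_s(G)=4s(s+1)-2$ for every royal petunia $G$ that contains a petal $Pe_n$ with $n\ge N$ as a subgraph. Moreover, every royal petunia is outerplanar, and consequently $\mathrm{HG}_s(\mathcal{OP})\ge 4s(s+1)-2$. -/

import Mathlib

universe u

/-- The game `⟨G, h, g⟩`: the sage at `v` has a hat of one of `h v` colours and makes (at most)
`g v` guesses, depending only on the hat colours of the neighbours of `v`. The game is winning if
some strategy `f` guarantees, for every hat placement `c`, at least one correct guess. -/
def HatGameWinning {V : Type u} (G : SimpleGraph V) (h g : V → ℕ) : Prop :=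
  ∃ f : (v : V) → ((w : G.neighborSet v) → Fin (h w)) → Finset (Fin (h v)),
    (∀ v x, (f v x).card ≤ g v) ∧
    ∀ c : (v : V) → Fin (h v), ∃ v, c v ∈ f v (fun w => c w)

/-- The hat guessing number `HG_s(G)`: the largest `k` such that the game with `k` colours and
`s` guesses for every sage is winning (`⊤` if there are arbitrarily large such `k`). -/
noncomputable def hatGuessingNumber {V : Type u} (s : ℕ) (G : SimpleGraph V) : ℕ∞ :=
  sSup {x : ℕ∞ | ∃ k : ℕ, x = (k : ℕ∞) ∧ HatGameWinning G (fun _ => k) (fun _ => s)}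

/-- `HG_s(𝒞) = sup {HG_s(G) : G ∈ 𝒞}` for a class `𝒞` of (finite) graphs. -/
noncomputable def classHatGuessingNumber (s : ℕ) (C : (V : Type u) → SimpleGraph V → Prop) : ℕ∞ :=
  sSup {x : ℕ∞ | ∃ (V : Type u) (_ : Finite V) (G : SimpleGraph V),
    C V G ∧ x = hatGuessingNumber s G}

/-- The petal graph `Pe_n`: the path on `n` vertices `some i`, and the stem `none` adjacent to
every vertex of the path. -/
def petalGraph (n : ℕ) : SimpleGraph (Option (Fin n)) where
  Adj
    | none, none => False
    | none, some _ => True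
    | some _, none => True
    | some i, some j => (SimpleGraph.pathGraph n).Adj i j
  symm := ⟨by
    rintro (_ | i) (_ | j) h
    · exact h
    · trivial
    · trivial
    · exact SimpleGraph.Adj.symm (G := SimpleGraph.pathGraph n) h⟩
  loopless := ⟨by
    rintro (_ | i) h
    · exact h
    · exact SimpleGraph.irrefl (SimpleGraph.pathGraph n) h⟩

/-- `G` is (a copy of) a petal `Pe_n`, `n ≥ 1`, with stem `a`. -/
def IsPetalWithStem {V : Type u} (G : SimpleGraph V) (a : V) : Prop :=
  ∃ n : ℕ, 1 ≤ n ∧ ∃ φ : petalGraph n ≃g G, φ none = a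

/-- Royal petunias: petals, and all graphs obtained from a royal petunia `H` by gluing the stem of
a new petal `K` to a vertex `a` of `H`, so that `G = H ∪ K` and `V(H) ∩ V(K) = {a}`. -/
inductive IsRoyalPetunia : {V : Type u} → SimpleGraph V → Prop
  | petal {V : Type u} (G : SimpleGraph V) (a : V) (hG : IsPetalWithStem G a) : IsRoyalPetunia G
  | glue {V : Type u} (G : SimpleGraph V) (H K : G.Subgraph) (a : V) (ha : a ∈ K.verts)
      (hunion : H ⊔ K = ⊤) (hinter : H.verts ∩ K.verts = {a})
      (hH : IsRoyalPetunia H.coe) (hK : IsPetalWithStem K.coe ⟨a, ha⟩) : IsRoyalPetunia G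

/-- A crossing-free drawing of `G` in the plane: vertices are distinct points, every edge is a
simple arc joining its two ends and containing no other vertex, and two different edges meet only
in vertices. -/
structure PlaneDrawing {V : Type u} (G : SimpleGraph V) where
  pos : V → ℝ × ℝ
  arc : G.edgeSet → Set (ℝ × ℝ)
  pos_injective : Function.Injective pos
  arc_isArc : ∀ (v w : V) (h : G.Adj v w), ∃ γ : Path (pos v) (pos w),
    Function.Injective γ ∧ Set.range γ = arc ⟨s(v, w), h⟩
  mem_of_pos_mem_arc : ∀ (e : G.edgeSet) (v : V), pos v ∈ arc e → v ∈ (e : Sym2 V)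
  arc_inter_subset : ∀ e f : G.edgeSet, e ≠ f → arc e ∩ arc f ⊆ Set.range pos

/-- The set of points of the plane covered by a drawing. -/
def PlaneDrawing.carrier {V : Type u} {G : SimpleGraph V} (D : PlaneDrawing G) : Set (ℝ × ℝ) :=
  Set.range D.pos ∪ ⋃ e, D.arc e

/-- `G` is outerplanar: it has a crossing-free drawing in the plane such that every vertex lies on
the boundary of the outer face, i.e. of the unbounded component of the complement. -/
def IsOuterplanar {V : Type u} (G : SimpleGraph V) : Prop :=
  ∃ D : PlaneDrawing G, ∃ x ∈ D.carrierᶜ,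
    ¬ Bornology.IsBounded (connectedComponentIn D.carrierᶜ x) ∧
    ∀ v, D.pos v ∈ frontier (connectedComponentIn D.carrierᶜ x)

/-! Put g = s(s+1). The value 4g - 2 is the threshold for paths whose sages make g guesses each:
against 4g - 1 colours every path loses (`exists_path_coloring_avoiding`), while with k = 4g - 2
colours a path of k vertices wins (`card_pathGuess_le`, `exists_mem_pathGuess`). The stem converts s
guesses into g.

Upper bound: for any s + 1 stem colours, merging the guesses of each path sage over these colours
gives at most g guesses, so a single path colouring defeats the path for all s + 1 colours at once.
Hence a petal can be stripped off: a winning strategy survives on the graph without it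
(`IsPetalExtension.exists_isWinningStrategy`). Iterating leaves a single sage, who loses.

Lower bound: reserve a block of k path vertices for each set T of s + 1 stem colours and distribute
the g guesses of each sage of the block among the colours of T. For every path colouring some colour
of T then makes a path sage correct, so at most s stem colours defeat the whole path. The stem sees
the path and guesses exactly these.

Outerplanarity: on a line, the path of a new petal fits immediately to the right of its stem without
crossings. Moving the line to a parabola and drawing edges as chords leaves the region below the
parabola in the outer face. -/

/-! ### Strategies and monotonicity -/

/-- A winning strategy of the game with `k` colours and `s` guesses, where every sage is given
the whole hat placement but uses only the hats of the neighbours. -/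
structure IsWinningStrategy {V : Type*} (G : SimpleGraph V) (k s : ℕ)
    (f : V → (V → Fin k) → Finset (Fin k)) : Prop where
  card_le : ∀ v c, (f v c).card ≤ s
  congr : ∀ v c c', (∀ w, G.Adj v w → c w = c' w) → f v c = f v c'
  exists_mem : ∀ c, ∃ v, c v ∈ f v c

theorem hatGameWinning_iff {V : Type u} {G : SimpleGraph V} {k s : ℕ} (hk : 0 < k) :
    HatGameWinning G (fun _ => k) (fun _ => s) ↔ ∃ f, IsWinningStrategy G k s f := by
  classical
  constructor
  · rintro ⟨f, hf, hwin⟩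
    refine ⟨fun v c => f v (fun w => c w), ⟨fun v c => hf _ _, fun v c c' h => ?_, hwin⟩⟩
    have : (fun w : G.neighborSet v => c w) = fun w : G.neighborSet v => c' w :=
      funext fun w => h w w.2
    simp only [this]
  · rintro ⟨f, hf⟩
    refine ⟨fun v x => f v (fun w => if h : G.Adj v w then x ⟨w, h⟩ else ⟨0, hk⟩),
      fun v x => hf.card_le _ _, fun c => ?_⟩
    obtain ⟨v, hv⟩ := hf.exists_mem c
    refine ⟨v, ?_⟩
    have h : f v (fun w => if h : G.Adj v w then c w else ⟨0, hk⟩) = f v c :=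
      hf.congr v _ c fun w hw => by simp [hw]
    exact h.symm.subset hv

theorem IsWinningStrategy.exists_of_injective {V W : Type*} {A : SimpleGraph W}
    {G : SimpleGraph V} {k s : ℕ} {f : W → (W → Fin k) → Finset (Fin k)}
    (hf : IsWinningStrategy A k s f) (φ : A →g G) (hφ : Function.Injective φ) :
    ∃ f', IsWinningStrategy G k s f' := by
  classical
  refine ⟨fun v c => if h : ∃ a, φ a = v then f h.choose (c ∘ φ) else ∅,
    ⟨fun v c => ?_, fun v c c' h => ?_, fun c => ?_⟩⟩
  · split_ifs
    · exact hf.card_le _ _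
    · simp
  · split_ifs with hv
    · refine hf.congr _ _ _ fun w hw => h _ ?_
      have := φ.map_adj hw
      rwa [hv.choose_spec] at this
    · rfl
  · obtain ⟨a, ha⟩ := hf.exists_mem (c ∘ φ)
    have hex : ∃ b, φ b = φ a := ⟨a, rfl⟩
    refine ⟨φ a, ?_⟩
    rw [dif_pos hex, hφ hex.choose_spec]
    exact ha

/-- The hat guessing number is a supremum over all winning `k`; by this monotonicity, excluding one
number of colours excludes all larger ones. -/
theorem IsWinningStrategy.exists_of_le {V : Type*} {G : SimpleGraph V} {k k' s : ℕ}
    {f : V → (V → Fin k) → Finset (Fin k)} (hf : IsWinningStrategy G k s f) (hk : k' ≤ k) :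
    ∃ f', IsWinningStrategy G k' s f' := by
  classical
  refine ⟨fun v c => Finset.univ.filter fun y => Fin.castLE hk y ∈ f v (Fin.castLE hk ∘ c),
    ⟨fun v c => ?_, fun v c c' h => ?_, fun c => ?_⟩⟩
  · refine le_trans ?_ (hf.card_le v (Fin.castLE hk ∘ c))
    refine Finset.card_le_card_of_injOn (Fin.castLE hk) (fun y hy => ?_)
      ((Fin.castLE_injective hk).injOn)
    simpa using hy
  · have : f v (Fin.castLE hk ∘ c) = f v (Fin.castLE hk ∘ c') :=
      hf.congr _ _ _ fun w hw => by simp [h w hw]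
    simp only [this]
  · obtain ⟨v, hv⟩ := hf.exists_mem (Fin.castLE hk ∘ c)
    exact ⟨v, by simpa using hv⟩

/-! ### Upper bound: stripping off petals -/

/-- On a path, `g` guesses do not suffice against `4 * g - 1` colours. -/
theorem exists_path_coloring_avoiding {k g : ℕ} (hg : 1 ≤ g) (hk : k + 1 = 4 * g)
    (F : ℕ → Fin k → Fin k → Finset (Fin k)) (hF : ∀ i y z, (F i y z).card ≤ g) (n : ℕ) :
    ∃ x : ℕ → Fin k, ∀ i < n, x (i + 1) ∉ F i (x i) (x (i + 2)) := by
  classical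
  -- One surviving colour would not sustain the induction; at least `2 * g` of them for every `z`
  -- do.
  let D : ℕ → Fin k → Finset (Fin k) := fun n z => Finset.univ.filter fun y =>
    ∃ x : ℕ → Fin k, x n = y ∧ x (n + 1) = z ∧ ∀ i < n, x (i + 1) ∉ F i (x i) (x (i + 2))
  have key : ∀ n z, 2 * g ≤ (D n z).card := by
    intro n
    induction n with
    | zero =>
      intro z
      have : D 0 z = Finset.univ := by
        ext y
        simp only [D, Finset.mem_filter, Finset.mem_univ, true_and, iff_true]
        exact ⟨fun i => if i = 0 then y else z, by simp, by simp, by simp⟩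
      rw [this, Finset.card_univ, Fintype.card_fin]
      omega
    | succ n ih =>
      intro z
      let B : Finset (Fin k) := Finset.univ.filter fun y => ∀ x ∈ D n y, y ∈ F n x z
      -- Double counting of pairs (`y` in `B`, `x` in `D n y`): each `y` has at least `2 * g`
      -- partners, each `x` at most `g`. Thus `2 * B.card ≤ k = 4 * g - 1`, and the complement of
      -- `B` again has at least `2 * g` colours.
      have hB : B.card * (2 * g) ≤ (Finset.univ : Finset (Fin k)).card * g := by
        refine Finset.card_mul_le_card_mul (fun y x => x ∈ D n y) (fun y _ => ?_) fun x _ => ?_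
        · refine (ih y).trans (Finset.card_le_card fun x hx => ?_)
          simpa [Finset.bipartiteAbove] using hx
        · refine (Finset.card_le_card fun y hy => ?_).trans (hF n x z)
          simp only [Finset.bipartiteBelow, Finset.mem_filter, B, Finset.mem_univ,
            true_and] at hy
          exact hy.1 x hy.2
      rw [Finset.card_univ, Fintype.card_fin] at hB
      have hB' : B.card * 2 ≤ k := by
        refine Nat.le_of_mul_le_mul_right ?_ hg
        linarith [hB]
      have hsub : Bᶜ ⊆ D (n + 1) z := by
        intro y hy
        simp only [B, Finset.mem_compl, Finset.mem_filter, Finset.mem_univ, true_and,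
          not_forall] at hy
        obtain ⟨x, hx, hyx⟩ := hy
        simp only [D, Finset.mem_filter, Finset.mem_univ, true_and] at hx ⊢
        obtain ⟨X, hX, hX', hXF⟩ := hx
        refine ⟨Function.update X (n + 2) z, ?_, by simp, fun i hi => ?_⟩
        · rw [Function.update_of_ne (by omega), hX']
        · rw [Function.update_of_ne (a := i + 1) (by omega),
            Function.update_of_ne (a := i) (by omega)]
          rcases Nat.lt_succ_iff_lt_or_eq.mp hi with hi' | rfl
          · rw [Function.update_of_ne (by omega)]
            exact hXF i hi'
          · rw [Function.update_self, hX, hX']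
            exact hyx
      have := Finset.card_le_card hsub
      rw [Finset.card_compl, Fintype.card_fin] at this
      omega
  have hpos : 0 < k := by omega
  have := key n ⟨0, hpos⟩
  obtain ⟨y, hy⟩ : (D n ⟨0, hpos⟩).Nonempty := Finset.card_pos.mp (by omega)
  simp only [D, Finset.mem_filter, Finset.mem_univ, true_and] at hy
  obtain ⟨x, -, -, hx⟩ := hy
  exact ⟨x, hx⟩

/-- `G` arises from `H` by gluing the stem of a petal with `n` path vertices to the vertex `a`
(possibly with some edges deleted). -/
structure IsPetalExtension {W : Type*} {n : ℕ} (G : SimpleGraph (W ⊕ Fin n)) (H : SimpleGraph W)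
    (a : W) : Prop where
  inl_inl : ∀ w w', G.Adj (.inl w) (.inl w') → H.Adj w w'
  inr_inl : ∀ i w, G.Adj (.inr i) (.inl w) → w = a
  inr_inr : ∀ i m, G.Adj (.inr i) (.inr m) → i.val + 1 = m.val ∨ m.val + 1 = i.val

/-- For any `s + 1` colours of the stem, the path can be coloured so that no path sage guesses
correctly, whichever of these colours the stem gets. -/
theorem IsPetalExtension.exists_path_coloring {W : Type*} {n k s : ℕ}
    {G : SimpleGraph (W ⊕ Fin n)} {H : SimpleGraph W} {a : W} (hG : IsPetalExtension G H a)
    (hs : 1 ≤ s) (hk : k + 1 = 4 * (s * (s + 1)))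
    {f : W ⊕ Fin n → (W ⊕ Fin n → Fin k) → Finset (Fin k)} (hf : IsWinningStrategy G k s f)
    (T : Finset (Fin k)) (hT : T.card = s + 1) :
    ∃ p : Fin n → Fin k, ∀ x : W → Fin k, x a ∈ T →
      ∀ i, p i ∉ f (.inr i) (Sum.elim x p) := by
  classical
  obtain ⟨X, hX⟩ := exists_path_coloring_avoiding (k := k) (g := s * (s + 1))
    (Nat.mul_pos hs s.succ_pos) hk
    -- A path sage sees at most the stem and the two path neighbours, so a placement equal to `y` on
    -- its left and `z` on its right represents everything it sees. Path vertex `m` is at position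
    -- `m + 1`, which leaves dummy positions at both ends.
    (fun i y z => if h : i < n then T.biUnion fun j =>
      f (.inr ⟨i, h⟩) (Sum.elim (fun _ => j) fun m => if m.val < i then y else z) else ∅)
    (fun i y z => by
      split_ifs
      · refine (Finset.card_biUnion_le_card_mul _ _ s fun j _ => hf.card_le _ _).trans ?_
        rw [hT, mul_comm]
      · simp) n
  refine ⟨fun m => X (m + 1), fun x hx i hi => ?_⟩
  have := hX i i.2
  rw [dif_pos i.2] at this
  refine this (Finset.mem_biUnion.mpr ⟨x a, hx, ?_⟩)
  rw [hf.congr _ _ (Sum.elim x fun m => X (m + 1))]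
  · exact hi
  · rintro (w | m) hw
    · simp [hG.inr_inl _ _ hw]
    · rcases hG.inr_inr _ _ hw with h | h
      · simp only [Sum.elim_inr]
        rw [if_neg (by dsimp only at h; omega), ← h]
      · simp only [Sum.elim_inr]
        rw [if_pos (by dsimp only at h; omega), h]

/-- In `H`, the stem guesses the colours that it would guess in `G` against every path colouring
safe for that colour. Were there `s + 1` of them, one path colouring would be safe for all, and the
stem, blind to its own hat, would make `s + 1` guesses against it. The other sages of `H` do not see
the path, so a constant colouring `z` serves them. -/
theorem IsPetalExtension.exists_isWinningStrategy {W : Type*} {n k s : ℕ}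
    {G : SimpleGraph (W ⊕ Fin n)} {H : SimpleGraph W} {a : W} (hG : IsPetalExtension G H a)
    (hs : 1 ≤ s) (hk : k + 1 = 4 * (s * (s + 1)))
    {f : W ⊕ Fin n → (W ⊕ Fin n → Fin k) → Finset (Fin k)} (hf : IsWinningStrategy G k s f) :
    ∃ f', IsWinningStrategy H k s f' := by
  classical
  have hk0 : 0 < k := by
    have := Nat.mul_pos hs s.succ_pos
    omega
  let z : Fin n → Fin k := fun _ => ⟨0, hk0⟩
  let S : (W → Fin k) → Finset (Fin k) := fun x => Finset.univ.filter fun j =>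
    ∀ p : Fin n → Fin k, (∀ i, p i ∉ f (.inr i) (Sum.elim (Function.update x a j) p)) →
      j ∈ f (.inl a) (Sum.elim x p)
  refine ⟨fun w x => if w = a then S x else f (.inl w) (Sum.elim x z),
    ⟨fun w x => ?_, fun w x x' h => ?_, fun x => ?_⟩⟩
  · split_ifs with hw
    · by_contra! hcard
      obtain ⟨T, hTS, hT⟩ := Finset.exists_subset_card_eq (Nat.succ_le_of_lt hcard)
      obtain ⟨p, hp⟩ := hG.exists_path_coloring hs hk hf T hT
      have hsub : T ⊆ f (.inl a) (Sum.elim x p) := by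
        intro j hj
        have hjS := hTS hj
        simp only [S, Finset.mem_filter, Finset.mem_univ, true_and] at hjS
        exact hjS p (hp _ (by simpa using hj))
      have h1 := Finset.card_le_card hsub
      have h2 := hf.card_le (.inl a) (Sum.elim x p)
      omega
    · exact hf.card_le _ _
  · split_ifs with hw
    · subst hw
      have h1 : ∀ p i j, f (.inr i) (Sum.elim (Function.update x w j) p)
          = f (.inr i) (Sum.elim (Function.update x' w j) p) := by
        intro p i j
        refine hf.congr _ _ _ ?_
        rintro (w' | m) hw'
        · simp [hG.inr_inl _ _ hw']
        · rfl
      have h2 : ∀ p, f (.inl w) (Sum.elim x p) = f (.inl w) (Sum.elim x' p) := by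
        intro p
        refine hf.congr _ _ _ ?_
        rintro (w' | m) hw'
        · exact h _ (hG.inl_inl _ _ hw')
        · rfl
      simp only [S, h1, h2]
    · refine hf.congr _ _ _ ?_
      rintro (w' | m) hw'
      · exact h _ (hG.inl_inl _ _ hw')
      · rfl
  · by_contra! hcon
    have ha := hcon a
    simp only [if_true, S, Finset.mem_filter, Finset.mem_univ, true_and, not_forall,
      Function.update_eq_self] at ha
    obtain ⟨p, hp, hap⟩ := ha
    obtain ⟨v | i, hv⟩ := hf.exists_mem (Sum.elim x p)
    · by_cases hva : v = a
      · subst hva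
        exact hap hv
      · have h := hcon v
        rw [if_neg hva, hf.congr _ _ (Sum.elim x p)] at h
        · exact h hv
        · rintro (w' | m) hw'
          · rfl
          · exact absurd (hG.inr_inl _ _ hw'.symm) hva
    · exact hp i hv

theorem not_isWinningStrategy_of_subsingleton {V : Type*} [Subsingleton V] (G : SimpleGraph V)
    {k s : ℕ} (hk : s < k) (f : V → (V → Fin k) → Finset (Fin k)) :
    ¬ IsWinningStrategy G k s f := by
  intro hf
  obtain ⟨v, -⟩ := hf.exists_mem fun _ => ⟨0, by omega⟩
  have : ∃ j, j ∉ f v fun _ => ⟨0, by omega⟩ := by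
    by_contra! h
    have h1 := hf.card_le v fun _ => ⟨0, by omega⟩
    rw [Finset.eq_univ_of_forall h, Finset.card_univ, Fintype.card_fin] at h1
    omega
  obtain ⟨j, hj⟩ := this
  obtain ⟨w, hw⟩ := hf.exists_mem fun _ => j
  obtain rfl := Subsingleton.elim v w
  rw [hf.congr _ _ fun _ => ⟨0, by omega⟩] at hw
  · exact hj hw
  · intro w hvw
    exact absurd hvw (by rw [Subsingleton.elim w v]; exact G.irrefl)

theorem exists_isWinningStrategy_comap {V W : Type*} {G : SimpleGraph V} {k s : ℕ}
    {f : V → (V → Fin k) → Finset (Fin k)} (hf : IsWinningStrategy G k s f) (e : W ≃ V) :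
    ∃ f', IsWinningStrategy (G.comap e) k s f' :=
  hf.exists_of_injective (SimpleGraph.Iso.comap e G).symm.toHom
    (SimpleGraph.Iso.comap e G).symm.injective

/-- The decomposition of a graph into a subgraph and the path of a petal glued to it. -/
theorem exists_isPetalExtension {V : Type*} {G : SimpleGraph V} {H K : G.Subgraph} {a : V}
    (ha : a ∈ K.verts) (hunion : H ⊔ K = ⊤) (hinter : H.verts ∩ K.verts = {a})
    (hK : IsPetalWithStem K.coe ⟨a, ha⟩) :
    ∃ (n : ℕ) (e : H.verts ⊕ Fin n ≃ V) (haH : a ∈ H.verts),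
      IsPetalExtension (G.comap e) H.coe ⟨a, haH⟩ := by
  obtain ⟨n, -, φ, hφ⟩ := hK
  have haH : a ∈ H.verts := (hinter.symm.subset (Set.mem_singleton a)).1
  have hinr : ∀ i, (φ (some i) : V) ∉ H.verts := fun i hi => by
    have h1 : (φ (some i) : V) = a := hinter.subset ⟨hi, (φ (some i)).2⟩
    have h2 : φ (some i) = φ none := by rw [hφ]; exact Subtype.ext h1
    exact absurd (φ.injective h2) (by simp)
  let E : H.verts ⊕ Fin n → V := Sum.elim (fun w => w) fun i => φ (some i)
  have hinj : Function.Injective E := by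
    rintro (w | i) (w' | m) h
    · exact congrArg Sum.inl (Subtype.ext h)
    · exact absurd (show (w : V) = φ (some m) from h) fun h => hinr m (h ▸ w.2)
    · exact absurd (show φ (some i) = (w' : V) from h) fun h => hinr i (h ▸ w'.2)
    · have := φ.injective (Subtype.ext h : φ (some i) = φ (some m))
      simpa using this
  have hsurj : Function.Surjective E := by
    intro v
    by_cases hv : v ∈ H.verts
    · exact ⟨.inl ⟨v, hv⟩, rfl⟩
    · have hvK : v ∈ K.verts := by
        have : v ∈ (H ⊔ K).verts := by rw [hunion]; trivial
        exact this.resolve_left hv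
      obtain ⟨o, ho⟩ := φ.surjective ⟨v, hvK⟩
      rcases o with _ | i
      · rw [hφ] at ho
        have h : a = v := congrArg Subtype.val ho
        exact absurd (h ▸ haH) hv
      · exact ⟨.inr i, congrArg Subtype.val ho⟩
  have hadj : ∀ {v w}, G.Adj v w → H.Adj v w ∨ K.Adj v w := by
    intro v w h
    have : (H ⊔ K).Adj v w := by rw [hunion]; exact h
    exact this
  refine ⟨n, Equiv.ofBijective E ⟨hinj, hsurj⟩, haH, ⟨?_, ?_, ?_⟩⟩
  · intro w w' h
    have h : G.Adj w w' := h
    rcases hadj h with h' | h'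
    · exact h'
    · have h1 : (w : V) = a := hinter.subset ⟨w.2, K.edge_vert h'⟩
      have h2 : (w' : V) = a := hinter.subset ⟨w'.2, K.edge_vert h'.symm⟩
      rw [h1, h2] at h
      exact absurd h G.irrefl
  · intro i w h
    have h : G.Adj (φ (some i)) w := h
    rcases hadj h with h' | h'
    · exact absurd (H.edge_vert h') (hinr i)
    · exact Subtype.ext (hinter.subset ⟨w.2, K.edge_vert h'.symm⟩)
  · intro i m h
    have h : G.Adj (φ (some i)) (φ (some m)) := h
    rcases hadj h with h' | h'
    · exact absurd (H.edge_vert h') (hinr i)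
    · have : (petalGraph n).Adj (some i) (some m) := φ.map_adj_iff.mp h'
      exact SimpleGraph.pathGraph_adj.mp this

theorem IsRoyalPetunia.not_isWinningStrategy {V : Type u} {G : SimpleGraph V}
    (hG : IsRoyalPetunia G) {k s : ℕ} (hs : 1 ≤ s) (hk : k + 1 = 4 * (s * (s + 1))) :
    ∀ f, ¬ IsWinningStrategy G k s f := by
  induction hG with
  | petal G a hG =>
    intro f hf
    obtain ⟨n, -, φ, hφ⟩ := hG
    -- A petal is itself a petal extension of a single vertex, so the induction bottoms out at one
    -- lone sage.
    let e : Unit ⊕ Fin n ≃ _ :=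
      ((Equiv.sumComm _ _).trans (Equiv.optionEquivSumPUnit (Fin n)).symm).trans φ.toEquiv
    obtain ⟨f', hf'⟩ := exists_isWinningStrategy_comap hf e
    have hext : IsPetalExtension (G.comap e) (⊥ : SimpleGraph Unit) () := by
      refine ⟨fun w w' h => absurd h G.irrefl, fun _ _ _ => rfl, fun i m h => ?_⟩
      have : (petalGraph n).Adj (some i) (some m) := φ.map_adj_iff.mp h
      exact SimpleGraph.pathGraph_adj.mp this
    obtain ⟨f'', hf''⟩ := hext.exists_isWinningStrategy hs hk hf'
    refine not_isWinningStrategy_of_subsingleton _ ?_ _ hf''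
    nlinarith
  | glue G H K a ha hunion hinter hH hK ih =>
    intro f hf
    obtain ⟨n, e, haH, hext⟩ := exists_isPetalExtension ha hunion hinter hK
    obtain ⟨f', hf'⟩ := exists_isWinningStrategy_comap hf e
    obtain ⟨f'', hf''⟩ := hext.exists_isWinningStrategy hs hk hf'
    exact ih f'' hf''

theorem IsRoyalPetunia.hatGuessingNumber_le {V : Type u} {G : SimpleGraph V}
    (hG : IsRoyalPetunia G) {s : ℕ} (hs : 1 ≤ s) :
    hatGuessingNumber s G ≤ ((4 * s * (s + 1) - 2 : ℕ) : ℕ∞) := by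
  refine sSup_le ?_
  rintro _ ⟨k, rfl, hk⟩
  by_contra! hlt
  have hlt : 4 * s * (s + 1) - 2 < k := by exact_mod_cast hlt
  obtain ⟨f, hf⟩ := (hatGameWinning_iff (by omega)).mp hk
  have h1 : 1 ≤ s * (s + 1) := Nat.mul_pos hs s.succ_pos
  rw [mul_assoc] at hlt
  obtain ⟨f', hf'⟩ := hf.exists_of_le (k' := 4 * (s * (s + 1)) - 1) (by omega)
  exact hG.not_isWinningStrategy hs (by omega) f' hf'

/-! ### Lower bound: guessing on a path by cyclic intervals -/

/-- Consecutive cyclic intervals of length `d` in `ZMod k`, of which there are `b` with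
`b * d ≤ g * k`, cover every point at most `g` times. -/
theorem card_filter_intervals_le {k g b d : ℕ} (hd : 0 < d) (hbd : b * d ≤ g * k) (x : ℤ) :
    ((Finset.range b).filter fun t : ℕ => (x - t * d) % (k : ℤ) < d).card ≤ g := by
  rcases Nat.eq_zero_or_pos k with rfl | hk
  · have : b = 0 := by
      rcases Nat.eq_zero_or_pos b with h | h
      · exact h
      · have := Nat.mul_pos h hd
        omega
    simp [this]
  have hkz : (0 : ℤ) < k := by exact_mod_cast hk
  have hdz : (0 : ℤ) < d := by exact_mod_cast hd
  have hbz : (b : ℤ) * d ≤ g * k := by exact_mod_cast hbd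
  set q : ℤ := x / k
  have hx0 : x - q * k = x % k := by rw [Int.emod_def]; ring
  have hx1 := Int.emod_nonneg x hkz.ne'
  have hx2 := Int.emod_lt_of_pos x hkz
  have hdec : ∀ t : ℕ, (x - t * d) = (x - t * d) % (k : ℤ) + k * ((x - t * d) / k) := fun t =>
    (Int.emod_add_mul_ediv _ _).symm
  rw [← Finset.card_range g]
  -- Count the turns of the circle between `x` and `x - t * d`. Steps of length `d` hit a window of
  -- length `d` at most once per turn, and `b * d ≤ g * k` leaves room for only `g` turns.
  refine Finset.card_le_card_of_injOn (fun t => (q - (x - t * d) / k).toNat) ?_ ?_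
  · intro t ht
    simp only [Finset.coe_filter, Finset.mem_range, Set.mem_ofPred_eq] at ht
    have h1 := hdec t
    have h2 := Int.emod_nonneg (x - t * d) hkz.ne'
    have htb : (t : ℤ) + 1 ≤ b := by exact_mod_cast ht.1
    have h3 : (q - (x - t * d) / k) * k < g * k := by nlinarith
    have h4 : q - (x - t * d) / k < g := lt_of_mul_lt_mul_right h3 hkz.le
    have hg : (0 : ℤ) < g := by
      have : (0 : ℤ) < b * d := by nlinarith
      by_contra hneg
      nlinarith
    simp only [Finset.coe_range, Set.mem_Iio]
    omega
  · intro t ht t' ht' h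
    simp only [Finset.coe_filter, Finset.mem_range, Set.mem_ofPred_eq] at ht ht'
    have hnn : ∀ t : ℕ, (x - t * d) % (k : ℤ) < d → 0 ≤ q - (x - t * d) / k := by
      intro t ht
      have h1 := hdec t
      have h2 := Int.emod_nonneg (x - t * d) hkz.ne'
      have h3 : (0 : ℤ) ≤ t * d := by positivity
      have : (-1) * (k : ℤ) < (q - (x - t * d) / k) * k := by nlinarith
      have := lt_of_mul_lt_mul_right this hkz.le
      omega
    have heq : (x - t * d) / (k : ℤ) = (x - t' * d) / k := by
      have h1 := hnn t ht.2
      have h2 := hnn t' ht'.2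
      simp only at h
      omega
    have h1 := hdec t
    have h2 := hdec t'
    have h3 := Int.emod_nonneg (x - t * d) hkz.ne'
    have h4 := Int.emod_nonneg (x - t' * d) hkz.ne'
    rw [heq] at h1
    have h5 : ((t : ℤ) - t') * d < 1 * d := by linarith [ht.2, ht'.2]
    have h6 : ((t' : ℤ) - t) * d < 1 * d := by linarith [ht.2, ht'.2]
    have h7 := lt_of_mul_lt_mul_right h5 hdz.le
    have h8 := lt_of_mul_lt_mul_right h6 hdz.le
    omega

/-- The guesses of the `i`-th sage on the path: the colours `y` lying in the cyclic interval of
length `i + 1` which is the complement of the interval of length `k - (i + 1)` with starting point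
`z * (k - (i + 1))`, and such that `x` is in the interval of length `k - i` with starting point
`y * (k - i)`. -/
def pathGuess (k i : ℕ) (x z : Fin k) : Finset (Fin k) :=
  Finset.univ.filter fun y =>
    ((k - (i + 1 : ℕ) : ℤ) ≤ ((y : ℤ) - (z : ℤ) * (k - (i + 1 : ℕ))) % k) ∧
    ((x : ℤ) - (y : ℤ) * (k - (i : ℕ))) % k < k - (i : ℕ)

/-- The candidates `y` are `i + 1` cyclically consecutive colours, and their intervals of length `k
- i` are laid end to end; a guess is a candidate whose interval contains `x`. -/
theorem card_pathGuess_le {k g i : ℕ} (hk : k + 2 = 4 * g) (hi : i < k) (x z : Fin k) :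
    (pathGuess k i x z).card ≤ g := by
  have hkz : (0 : ℤ) < k := by
    have : 0 < k := by omega
    exact_mod_cast this
  obtain ⟨d, hd⟩ : ∃ d, k = i + d := ⟨k - i, by omega⟩
  have hdz : (k : ℤ) - (i : ℕ) = d := by
    rw [hd]; push_cast; ring
  have hdz' : (k : ℤ) - (i + 1 : ℕ) = d - 1 := by
    rw [hd]; push_cast; ring
  -- The first colour after the interval determined by `z`, where its complement starts.
  set σ : ℤ := z * (d - 1) + (d - 1)
  -- The integers `i + 1` and `d` add up to `4 * g - 1`, so their product is at most `2 * g * (2 * g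
  -- - 1) = g * k`.
  have hbd : (i + 1) * d ≤ g * k := by
    have h1 : (i + 1) + d + 1 = 4 * g := by omega
    have h2 : (k : ℤ) = 4 * g - 2 := by
      have : (k : ℤ) + 2 = 4 * g := by exact_mod_cast hk
      linarith
    zify
    rw [h2]
    have h3 : (d : ℤ) = 4 * g - 1 - (i + 1) := by
      have : ((i : ℤ) + 1) + d + 1 = 4 * g := by exact_mod_cast h1
      linarith
    rw [h3]
    have h4 : 0 ≤ ((i : ℤ) + 1 - 2 * g) * ((i : ℤ) + 1 - (2 * g - 1)) := by
      rcases le_or_gt ((i : ℤ) + 1) (2 * g - 1) with h | h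
      · exact mul_nonneg_of_nonpos_of_nonpos (by linarith) (by linarith)
      · exact mul_nonneg (by linarith [Int.add_one_le_of_lt h]) (by linarith)
    nlinarith
  refine le_trans ?_ (card_filter_intervals_le (k := k) (by omega) hbd ((x : ℤ) - σ * d))
  refine Finset.card_le_card_of_injOn (fun y : Fin k => (((y : ℤ) - σ) % k).toNat) ?_ ?_
  · intro y hy
    simp only [pathGuess, Finset.coe_filter, Finset.mem_univ, true_and, Set.mem_ofPred_eq, hdz,
      hdz'] at hy
    obtain ⟨hy1, hy2⟩ := hy
    have h0 := Int.emod_nonneg ((y : ℤ) - σ) hkz.ne'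
    have hlt := Int.emod_lt_of_pos ((y : ℤ) - z * (d - 1)) hkz
    have hmod : ((y : ℤ) - σ) % k = ((y : ℤ) - z * (d - 1)) % k - (d - 1) := by
      have h1 : ((y : ℤ) - σ) % k = (((y : ℤ) - z * (d - 1)) % k - (d - 1)) % k := by
        rw [Int.emod_sub_emod]
        congr 1
        simp only [σ]; ring
      rw [h1]
      have : (0 : ℤ) < d := by omega
      exact Int.emod_eq_of_lt (by linarith) (by linarith)
    simp only [Finset.coe_filter, Finset.mem_range, Set.mem_ofPred_eq]
    refine ⟨by omega, ?_⟩
    rw [Int.toNat_of_nonneg h0]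
    have : ((x : ℤ) - σ * d - ((y : ℤ) - σ) % k * d) % k = ((x : ℤ) - y * d) % k := by
      rw [Int.emod_def ((y : ℤ) - σ)]
      have : (x : ℤ) - σ * d - ((y : ℤ) - σ - k * (((y : ℤ) - σ) / k)) * d
          = (x - y * d) + k * ((((y : ℤ) - σ) / k) * d) := by ring
      rw [this, Int.add_mul_emod_self_left]
    rw [this]
    exact hy2
  · intro y _ y' _ h
    have h0 := Int.emod_nonneg ((y : ℤ) - σ) hkz.ne'
    have h1 := Int.emod_nonneg ((y' : ℤ) - σ) hkz.ne'
    have h2 : ((y : ℤ) - σ) % k = ((y' : ℤ) - σ) % k := by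
      simp only at h
      omega
    have h3 : (k : ℤ) ∣ (y' : ℤ) - y := by
      have := Int.ModEq.dvd h2
      simpa using this
    obtain ⟨m, hm⟩ := h3
    have hy := y.2
    have hy' := y'.2
    have hm0 : m = 0 := by
      have h4 : m * k < 1 * k := by linarith [mul_comm (k : ℤ) m]
      have h5 : (-1) * k < m * k := by linarith [mul_comm (k : ℤ) m]
      have := lt_of_mul_lt_mul_right h4 hkz.le
      have := lt_of_mul_lt_mul_right h5 hkz.le
      omega
    rw [hm0] at hm
    apply Fin.ext
    omega

/-- On a path with `k` vertices and `k` colours the guesses `pathGuess` always contain a correct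
one. -/
theorem exists_mem_pathGuess {k : ℕ} (X : ℕ → Fin k) :
    ∃ i < k, X (i + 1) ∈ pathGuess k i (X i) (X (i + 2)) := by
  by_contra! hcon
  have hk : 0 < k := (X 0).pos
  have hkz : (0 : ℤ) < k := by exact_mod_cast hk
  -- If all guesses fail, `X i` stays in the interval determined by `X (i + 1)`: trivial for `i =
  -- 0`, where the interval is everything, and absurd for `i = k`, where it is empty.
  have key : ∀ i ≤ k, ((X i : ℤ) - (X (i + 1) : ℤ) * (k - (i : ℕ))) % k < k - (i : ℕ) := by
    intro i
    induction i with
    | zero =>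
      intro _
      simpa using Int.emod_lt_of_pos _ hkz
    | succ i ih =>
      intro hi
      by_contra! hle
      refine hcon i hi ?_
      simp only [pathGuess, Finset.mem_filter, Finset.mem_univ, true_and]
      exact ⟨hle, ih (by omega)⟩
  have := key k le_rfl
  rw [sub_self] at this
  exact absurd (Int.emod_nonneg _ hkz.ne') (by linarith)

/-! ### Lower bound: a winning strategy on long petals -/

/-- Used to share the `s * (s + 1)` guesses of a path sage among `s + 1` stem colours. -/
theorem Finset.exists_cover_card_le {α β : Type*} [DecidableEq α] [DecidableEq β] {s : ℕ}
    (T : Finset β) (F : Finset α) (h : F.card ≤ s * T.card) :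
    ∃ P : β → Finset α, (∀ j, (P j).card ≤ s) ∧ ∀ y ∈ F, ∃ j ∈ T, y ∈ P j := by
  induction T using Finset.induction_on generalizing F with
  | empty =>
    have : F = ∅ := by simpa using h
    exact ⟨fun _ => ∅, by simp, by simp [this]⟩
  | insert b T hb ih =>
    rw [Finset.card_insert_of_notMem hb] at h
    obtain ⟨A, hAF, hA⟩ := Finset.exists_subset_card_eq (Nat.min_le_right s F.card)
    obtain ⟨P, hP, hPF⟩ := ih (F \ A) (by
      rw [Finset.card_sdiff_of_subset hAF, hA]
      rw [mul_add, mul_one] at h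
      omega)
    refine ⟨Function.update P b A, fun j => ?_, fun y hy => ?_⟩
    · by_cases hj : j = b
      · subst hj
        simp [hA]
      · rw [Function.update_of_ne hj]
        exact hP j
    · by_cases hyA : y ∈ A
      · exact ⟨b, by simp, by simpa using hyA⟩
      · obtain ⟨j, hj, hyj⟩ := hPF y (by simp [hy, hyA])
        refine ⟨j, by simp [hj], ?_⟩
        rw [Function.update_of_ne (by rintro rfl; exact hb hj)]
        exact hyj

theorem exists_isWinningStrategy_petalGraph {k s : ℕ} (hk : k + 2 = 4 * (s * (s + 1))) :
    ∃ N, ∀ n, N ≤ n → ∃ f, IsWinningStrategy (petalGraph n) k s f := by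
  classical
  have hk0 : 0 < k := by
    rcases Nat.eq_zero_or_pos (s * (s + 1)) with h | h <;> omega
  obtain ⟨M, ⟨enum⟩⟩ : ∃ M, Nonempty (Fin M ≃ {T : Finset (Fin k) // T.card = s + 1}) :=
    ⟨_, ⟨(Fintype.equivFin _).symm⟩⟩
  have hcover : ∀ (T : {T : Finset (Fin k) // T.card = s + 1}) (i : ℕ) (x z : Fin k),
      ∃ P : Fin k → Finset (Fin k), (∀ j, (P j).card ≤ s) ∧
        (i < k → ∀ y ∈ pathGuess k i x z, ∃ j ∈ T.1, y ∈ P j) := by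
    intro T i x z
    by_cases hi : i < k
    · obtain ⟨P, hP, hPF⟩ := Finset.exists_cover_card_le (s := s) T.1 (pathGuess k i x z) (by
        rw [T.2]
        exact card_pathGuess_le hk hi x z)
      exact ⟨P, hP, fun _ => hPF⟩
    · exact ⟨fun _ => ∅, by simp, fun h => absurd h hi⟩
  choose P hPcard hPcover using hcover
  -- One block of `k` vertices for each of the `M` sets of `s + 1` stem colours.
  refine ⟨M * k, fun n hn => ?_⟩
  let X : (Option (Fin n) → Fin k) → ℕ → Fin k := fun c i =>
    if h : 0 < i ∧ i - 1 < n then c (some ⟨i - 1, h.2⟩) else ⟨0, hk0⟩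
  have hXsucc : ∀ c (i : Fin n), X c (i + 1) = c (some i) := by
    intro c i
    simp [X]
  let fpath : Fin n → (Option (Fin n) → Fin k) → Finset (Fin k) := fun i c =>
    if h : i / k < M then P (enum ⟨i / k, h⟩) (i % k) (X c i) (X c (i + 2)) (c none) else ∅
  have hXupd : ∀ c j, X (Function.update c none j) = X c := by
    intro c j
    funext i
    simp [X]
  have hXcongr : ∀ (i : Fin n) (c c' : Option (Fin n) → Fin k),
      (∀ w, (petalGraph n).Adj (some i) w → c w = c' w) →
        X c i = X c' i ∧ X c (i + 2) = X c' (i + 2) := by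
    intro i c c' h
    constructor
    · simp only [X]
      split_ifs with hi
      · refine h _ (SimpleGraph.pathGraph_adj.mpr ?_)
        simp only
        omega
      · rfl
    · simp only [X]
      split_ifs with hi
      · refine h _ (SimpleGraph.pathGraph_adj.mpr ?_)
        simp only
        omega
      · rfl
  -- The stem guesses the colours for which every path sage fails; a set `T` of `s + 1` such colours
  -- is refuted in the block of `T`.
  refine ⟨fun v c => v.elim (Finset.univ.filter fun j =>
    ∀ i, c (some i) ∉ fpath i (Function.update c none j)) fun i => fpath i c, ⟨?_, ?_, ?_⟩⟩
  · rintro (_ | i) c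
    · simp only [Option.elim]
      by_contra! hcard
      obtain ⟨T, hTS, hT⟩ := Finset.exists_subset_card_eq (Nat.succ_le_of_lt hcard)
      obtain ⟨⟨q, hq⟩, hqT⟩ := enum.surjective ⟨T, hT⟩
      -- The path strategy tolerates arbitrary colours just outside a block, so blocks do not
      -- interfere.
      obtain ⟨r, hr, hmem⟩ := exists_mem_pathGuess fun i => X c (q * k + i)
      obtain ⟨j, hj, hjP⟩ := hPcover (enum ⟨q, hq⟩) r _ _ hr _ hmem
      rw [hqT] at hj
      have hin : q * k + r < n := by
        have : (q + 1) * k ≤ M * k := Nat.mul_le_mul_right k hq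
        rw [add_mul, one_mul] at this
        omega
      have hjS := hTS hj
      simp only [Finset.mem_filter, Finset.mem_univ, true_and] at hjS
      refine hjS ⟨q * k + r, hin⟩ ?_
      have hdiv : (q * k + r) / k = q := by
        rw [mul_comm, Nat.mul_add_div hk0, Nat.div_eq_of_lt hr, add_zero]
      have hmod : (q * k + r) % k = r := by
        rw [mul_comm, Nat.mul_add_mod, Nat.mod_eq_of_lt hr]
      simp only [fpath, hdiv, hmod, hXupd, Function.update_self, dif_pos hq]
      rw [← hXsucc c ⟨q * k + r, hin⟩]
      exact hjP
    · simp only [Option.elim, fpath]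
      split_ifs
      · exact hPcard _ _ _ _ _
      · simp
  · rintro (_ | i) c c' h
    · simp only [Option.elim]
      have hc : ∀ i, c (some i) = c' (some i) := fun i => h _ trivial
      have hupd : ∀ j, Function.update c none j = Function.update c' none j := by
        intro j
        funext v
        rcases v with _ | i
        · simp
        · simp [hc]
      simp only [hc, hupd]
    · obtain ⟨h1, h2⟩ := hXcongr i c c' h
      have h3 : c none = c' none := h none trivial
      simp only [Option.elim, fpath, h1, h2, h3]
  · intro c
    by_contra! hcon
    have h := hcon none
    simp only [Option.elim, Finset.mem_filter, Finset.mem_univ, true_and,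
      Function.update_eq_self] at h
    exact h fun i => hcon (some i)

theorem exists_le_hatGuessingNumber (s : ℕ) (hs : 1 ≤ s) :
    ∃ N : ℕ, ∀ n, N ≤ n → ∀ (V : Type u) (G : SimpleGraph V), (petalGraph n).IsContained G →
      ((4 * s * (s + 1) - 2 : ℕ) : ℕ∞) ≤ hatGuessingNumber s G := by
  have h1 : 1 ≤ s * (s + 1) := Nat.mul_pos hs s.succ_pos
  obtain ⟨N, hN⟩ := exists_isWinningStrategy_petalGraph (k := 4 * s * (s + 1) - 2) (s := s)
    (by rw [mul_assoc]; omega)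
  refine ⟨N, fun n hn V G ⟨φ⟩ => le_sSup ⟨_, rfl, ?_⟩⟩
  obtain ⟨f, hf⟩ := hN n hn
  exact (hatGameWinning_iff (by rw [mul_assoc]; omega)).mpr
    (hf.exists_of_injective φ.toHom φ.injective)

/-! ### Royal petunias have one-page embeddings -/

/-- The vertices of `G` can be placed on a line so that no two edges, drawn on the same side of
the line, cross. -/
def HasOnePageEmbedding {V : Type*} (G : SimpleGraph V) : Prop :=
  ∃ t : V → ℝ, Function.Injective t ∧ ∀ a b c d, G.Adj a b → G.Adj c d →
    t a < t c → t c < t b → t b < t d → False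

/-- The new path goes, in order, into a gap right of `a` free of old vertices. An old edge has no
end strictly inside this gap, and petal edges join `a` to the path or consecutive path vertices, so
no crossing arises. -/
theorem IsPetalExtension.hasOnePageEmbedding {W : Type*} [Finite W] {n : ℕ}
    {G : SimpleGraph (W ⊕ Fin n)} {H : SimpleGraph W} {a : W} (hG : IsPetalExtension G H a)
    (hH : HasOnePageEmbedding H) : HasOnePageEmbedding G := by
  obtain ⟨t, hinj, hcross⟩ := hH
  obtain ⟨δ, hδ, hgap⟩ : ∃ δ > 0, ∀ w, t a < t w → t a + δ ≤ t w := by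
    rcases isEmpty_or_nonempty {w // t a < t w} with hE | hne
    · exact ⟨1, one_pos, fun w hw => (hE.false ⟨w, hw⟩).elim⟩
    · obtain ⟨w, hw⟩ := Finite.exists_min fun w : {w // t a < t w} => t w
      exact ⟨t w - t a, sub_pos.mpr w.2, fun w' hw' => by linarith [hw ⟨w', hw'⟩]⟩
  have hn : (0 : ℝ) < n + 1 := by positivity
  let ε : ℝ := δ / (n + 1)
  have hε : 0 < ε := div_pos hδ hn
  let p : Fin n → ℝ := fun i => t a + ε * (i + 1)
  have hp0 : ∀ i, t a < p i := fun i => by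
    have : 0 < ε * ((i : ℝ) + 1) := by positivity
    simp only [p]; linarith
  have hp1 : ∀ i, p i < t a + δ := fun i => by
    have h1 : ((i : ℕ) : ℝ) < n := by exact_mod_cast i.2
    have h2 : ε * (n + 1) = δ := div_mul_cancel₀ _ hn.ne'
    have : ε * ((i : ℝ) + 1) < ε * (n + 1) := mul_lt_mul_of_pos_left (by linarith) hε
    simp only [p]; linarith
  have hplt : ∀ i j, p i < p j ↔ i < j := fun i j => by
    simp only [p]
    rw [add_lt_add_iff_left, mul_lt_mul_iff_right₀ hε, add_lt_add_iff_right, Nat.cast_lt]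
    rfl
  have hwp : ∀ w i, t w < p i → t w ≤ t a := fun w i h => by
    by_contra! hlt
    linarith [hgap w hlt, hp1 i]
  have hpw : ∀ w i, p i < t w → t a < t w := fun w i h => (hp0 i).trans h
  have hne : ∀ w i, t w ≠ p i := fun w i h => by
    have h1 := hp0 i
    rw [← h] at h1
    linarith [hgap w h1, hp1 i]
  refine ⟨Sum.elim t p, ?_, ?_⟩
  · rintro (w | i) (w' | m) h
    · exact congrArg _ (hinj h)
    · exact absurd h (hne w m)
    · exact absurd h.symm (hne w' i)
    · refine congrArg _ ?_
      rcases lt_trichotomy i m with h' | h' | h'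
      · exact absurd h ((hplt i m).mpr h').ne
      · exact h'
      · exact absurd h ((hplt m i).mpr h').ne'
  · have inl_inr : ∀ {w i}, G.Adj (.inl w) (.inr i) → w = a := fun h => hG.inr_inl _ _ h.symm
    rintro (x | i) (y | j) (z | l) (w | m) h1 h2 h3 h4 h5 <;>
      simp only [Sum.elim_inl, Sum.elim_inr] at h3 h4 h5
    · exact hcross _ _ _ _ (hG.inl_inl _ _ h1) (hG.inl_inl _ _ h2) h3 h4 h5
    · obtain rfl := inl_inr h2
      linarith [hwp _ _ h5]
    · obtain rfl := hG.inr_inl _ _ h2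
      linarith [hpw _ _ h4]
    · linarith [hwp _ _ h5, hpw _ _ h4]
    · obtain rfl := inl_inr h1
      linarith [hwp _ _ h4]
    · obtain rfl := inl_inr h1
      linarith [hwp _ _ h4]
    · obtain rfl := hG.inr_inl _ _ h2
      linarith [hp0 j]
    · rcases hG.inr_inr _ _ h2 with h | h
      · rw [hplt] at h4 h5
        omega
      · rw [hplt] at h4 h5
        omega
    · obtain rfl := hG.inr_inl _ _ h1
      linarith [hp0 i]
    · obtain rfl := hG.inr_inl _ _ h1
      linarith [hp0 i]
    · obtain rfl := hG.inr_inl _ _ h1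
      linarith [hp0 i]
    · obtain rfl := hG.inr_inl _ _ h1
      linarith [hp0 i]
    · linarith [hwp _ _ h4, hpw _ _ h3]
    · linarith [hwp _ _ h4, hpw _ _ h3]
    · obtain rfl := hG.inr_inl _ _ h2
      linarith [hp0 j]
    · rcases hG.inr_inr _ _ h1 with h | h
      · rw [hplt] at h3 h4
        omega
      · rw [hplt] at h3 h4
        omega

theorem HasOnePageEmbedding.of_comap {V W : Type*} {G : SimpleGraph V} (e : W ≃ V)
    (h : HasOnePageEmbedding (G.comap e)) : HasOnePageEmbedding G := by
  obtain ⟨t, hinj, hcross⟩ := h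
  refine ⟨t ∘ e.symm, hinj.comp e.symm.injective, fun a b c d hab hcd => ?_⟩
  exact hcross _ _ _ _ (by simpa using hab) (by simpa using hcd)

theorem IsRoyalPetunia.finite_and_hasOnePageEmbedding {V : Type u} {G : SimpleGraph V}
    (hG : IsRoyalPetunia G) : Finite V ∧ HasOnePageEmbedding G := by
  induction hG with
  | petal G a hG =>
    obtain ⟨n, -, φ, hφ⟩ := hG
    refine ⟨Finite.of_equiv _ φ.toEquiv, ?_⟩
    let e : Unit ⊕ Fin n ≃ _ :=
      ((Equiv.sumComm _ _).trans (Equiv.optionEquivSumPUnit (Fin n)).symm).trans φ.toEquiv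
    have hext : IsPetalExtension (G.comap e) (⊥ : SimpleGraph Unit) () := by
      refine ⟨fun w w' h => absurd h G.irrefl, fun _ _ _ => rfl, fun i m h => ?_⟩
      have : (petalGraph n).Adj (some i) (some m) := φ.map_adj_iff.mp h
      exact SimpleGraph.pathGraph_adj.mp this
    exact .of_comap e (hext.hasOnePageEmbedding
      ⟨fun _ => 0, Function.injective_of_subsingleton _, fun _ _ _ _ h => h.elim⟩)
  | glue G H K a ha hunion hinter hH hK ih =>
    obtain ⟨n, e, haH, hext⟩ := exists_isPetalExtension ha hunion hinter hK
    have := ih.1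
    exact ⟨Finite.of_equiv _ e, .of_comap e (hext.hasOnePageEmbedding ih.2)⟩

/-! ### Drawing a one-page embedding by chords of a parabola -/

/-- The point with abscissa `x` of the standard parabola. -/
def parabola (x : ℝ) : ℝ × ℝ := (x, x ^ 2)

theorem parabola_injective : Function.Injective parabola := fun _ _ h => congrArg Prod.fst h

/-- The height above the parabola, as a product, reduces intersections of chords to comparing two
products. -/
theorem mem_segment_parabola {a b : ℝ} {p : ℝ × ℝ}
    (hp : p ∈ segment ℝ (parabola a) (parabola b)) :
    p.2 - p.1 ^ 2 = (p.1 - a) * (b - p.1) ∧ min a b ≤ p.1 ∧ p.1 ≤ max a b := by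
  obtain ⟨u, v, hu, hv, huv, rfl⟩ := hp
  obtain rfl : u = 1 - v := by linarith
  simp only [parabola, Prod.smul_mk, Prod.mk_add_mk, smul_eq_mul]
  refine ⟨by ring, ?_, ?_⟩
  · nlinarith [min_le_left a b, min_le_right a b, mul_nonneg hu (sub_nonneg.mpr (min_le_left a b)),
      mul_nonneg hv (sub_nonneg.mpr (min_le_right a b))]
  · nlinarith [mul_nonneg hu (sub_nonneg.mpr (le_max_left a b)),
      mul_nonneg hv (sub_nonneg.mpr (le_max_right a b))]

theorem sq_le_of_mem_segment_parabola {a b : ℝ} {p : ℝ × ℝ}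
    (hp : p ∈ segment ℝ (parabola a) (parabola b)) : p.1 ^ 2 ≤ p.2 := by
  obtain ⟨u, v, hu, hv, huv, rfl⟩ := hp
  obtain rfl : u = 1 - v := by linarith
  simp only [parabola, Prod.smul_mk, Prod.mk_add_mk, smul_eq_mul]
  nlinarith [mul_nonneg (mul_nonneg hu hv) (sq_nonneg (a - b))]

/-- Two distinct non-crossing chords of the parabola meet only in their ends. -/
theorem eq_parabola_of_mem_inter {a b c d : ℝ} (hab : a < b) (hcd : c < d)
    (hne : a ≠ c ∨ b ≠ d) (h1 : ¬ (a < c ∧ c < b ∧ b < d)) (h2 : ¬ (c < a ∧ a < d ∧ d < b))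
    {p : ℝ × ℝ} (hp : p ∈ segment ℝ (parabola a) (parabola b))
    (hp' : p ∈ segment ℝ (parabola c) (parabola d)) :
    p.2 = p.1 ^ 2 := by
  obtain ⟨hp1, hp2, hp3⟩ := mem_segment_parabola hp
  obtain ⟨hp1', hp2', hp3'⟩ := mem_segment_parabola hp'
  rw [min_eq_left hab.le] at hp2
  rw [max_eq_right hab.le] at hp3
  rw [min_eq_left hcd.le] at hp2'
  rw [max_eq_right hcd.le] at hp3'
  by_contra hcon
  have hpos : (p.1 - a) * (b - p.1) ≠ 0 := fun h => hcon (by linarith)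
  have hpos' : (p.1 - c) * (d - p.1) ≠ 0 := fun h => hcon (by linarith)
  have ha : 0 < p.1 - a := lt_of_le_of_ne (by linarith) (left_ne_zero_of_mul hpos).symm
  have hb : 0 < b - p.1 := lt_of_le_of_ne (by linarith) (right_ne_zero_of_mul hpos).symm
  have hc : 0 < p.1 - c := lt_of_le_of_ne (by linarith) (left_ne_zero_of_mul hpos').symm
  have hd : 0 < d - p.1 := lt_of_le_of_ne (by linarith) (right_ne_zero_of_mul hpos').symm
  -- Non-crossing intervals that share an inner point are nested, and the strictly larger one gives
  -- the strictly larger product.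
  have heq : (p.1 - a) * (b - p.1) = (p.1 - c) * (d - p.1) := by rw [← hp1, ← hp1']
  rcases lt_trichotomy a c with h | h | h
  · have hdb : d ≤ b := not_lt.mp fun h' => h1 ⟨h, by linarith, h'⟩
    have := mul_lt_mul_of_pos_right (show p.1 - c < p.1 - a by linarith) hd
    have := mul_le_mul_of_nonneg_left (show d - p.1 ≤ b - p.1 by linarith) ha.le
    linarith
  · subst h
    have := mul_left_cancel₀ ha.ne' heq
    rcases hne with h | h
    · exact h rfl
    · exact h (by linarith)
  · have hbd : b ≤ d := not_lt.mp fun h' => h2 ⟨h, by linarith, h'⟩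
    have := mul_lt_mul_of_pos_right (show p.1 - a < p.1 - c by linarith) hb
    have := mul_le_mul_of_nonneg_left (show b - p.1 ≤ d - p.1 by linarith) hc.le
    linarith

/-- The chord of the parabola that draws an edge. -/
def chord {V : Type*} (t : V → ℝ) (e : Sym2 V) : Set (ℝ × ℝ) :=
  Sym2.lift ⟨fun v w => segment ℝ (parabola (t v)) (parabola (t w)),
    fun _ _ => segment_symm ℝ _ _⟩ e

theorem exists_lt_of_mem_edgeSet {V : Type*} {G : SimpleGraph V} {t : V → ℝ}
    (ht : Function.Injective t) {e : Sym2 V} (he : e ∈ G.edgeSet) :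
    ∃ v w, e = s(v, w) ∧ G.Adj v w ∧ t v < t w := by
  induction e using Sym2.ind with
  | _ v w =>
    have h : G.Adj v w := he
    rcases lt_or_gt_of_ne (ht.ne h.ne) with h' | h'
    · exact ⟨v, w, rfl, h, h'⟩
    · exact ⟨w, v, Sym2.eq_swap, h.symm, h'⟩

theorem mem_of_parabola_mem_chord {V : Type*} {t : V → ℝ} (ht : Function.Injective t)
    {e : Sym2 V} {v : V} (h : parabola (t v) ∈ chord t e) : v ∈ e := by
  induction e using Sym2.ind with
  | _ a b =>
    have := (mem_segment_parabola h).1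
    simp only [parabola, sub_self] at this
    rcases mul_eq_zero.mp this.symm with h' | h'
    · simp [ht (sub_eq_zero.mp h')]
    · simp [ht (sub_eq_zero.mp h')]

theorem mem_chord_of_sq_eq {V : Type*} {t : V → ℝ} {e : Sym2 V} {p : ℝ × ℝ}
    (h : p ∈ chord t e) (hp : p.2 = p.1 ^ 2) : p ∈ Set.range fun v => parabola (t v) := by
  induction e using Sym2.ind with
  | _ a b =>
    have := (mem_segment_parabola h).1
    rw [hp, sub_self] at this
    rcases mul_eq_zero.mp this.symm with h' | h'
    · exact ⟨a, Prod.ext (by simp only [parabola]; linarith)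
        (by simp only [parabola]; rw [hp, sub_eq_zero.mp h'])⟩
    · exact ⟨b, Prod.ext (by simp only [parabola]; linarith)
        (by simp only [parabola]; rw [hp, sub_eq_zero.mp h'])⟩

theorem exists_path_range_eq_segment {x y : ℝ × ℝ} (h : x ≠ y) :
    ∃ γ : Path x y, Function.Injective γ ∧ Set.range γ = segment ℝ x y := by
  refine ⟨⟨⟨fun s : unitInterval => AffineMap.lineMap x y (s : ℝ), by fun_prop⟩, by simp,
    by simp⟩, ?_, ?_⟩
  · intro s s' hs
    exact Subtype.ext (AffineMap.lineMap_injective ℝ h hs)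
  · rw [segment_eq_image_lineMap]
    ext p
    simp only [Set.mem_range, Set.mem_image]
    exact ⟨fun ⟨s, hs⟩ => ⟨s, s.2, hs⟩, fun ⟨s, hs, hp⟩ => ⟨⟨s, hs⟩, hp⟩⟩

theorem isPreconnected_below_parabola : IsPreconnected {p : ℝ × ℝ | p.2 < p.1 ^ 2} := by
  have h : {p : ℝ × ℝ | p.2 < p.1 ^ 2}
      = (fun p : ℝ × ℝ => (p.1, p.2 + p.1 ^ 2)) '' (Set.univ ×ˢ Set.Iio 0) := by
    ext p
    simp only [Set.mem_ofPred_eq, Set.mem_image, Set.mem_prod, Set.mem_univ, true_and, Set.mem_Iio]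
    constructor
    · intro hp
      exact ⟨(p.1, p.2 - p.1 ^ 2), by simpa using hp, by simp⟩
    · rintro ⟨q, hq, rfl⟩
      simpa using hq
  rw [h]
  exact (isPreconnected_univ.prod isPreconnected_Iio).image _ (by fun_prop)

theorem HasOnePageEmbedding.isOuterplanar {V : Type u} {G : SimpleGraph V}
    (h : HasOnePageEmbedding G) : IsOuterplanar G := by
  obtain ⟨t, hinj, hcross⟩ := h
  let D : PlaneDrawing G :=
    { pos := fun v => parabola (t v)
      arc := fun e => chord t e
      pos_injective := parabola_injective.comp hinj
      arc_isArc := fun v w hvw =>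
        exists_path_range_eq_segment ((parabola_injective.comp hinj).ne hvw.ne)
      mem_of_pos_mem_arc := fun e v hv => mem_of_parabola_mem_chord hinj hv
      arc_inter_subset := by
        rintro ⟨e, he⟩ ⟨f, hf⟩ hne p ⟨hpe, hpf⟩
        refine mem_chord_of_sq_eq hpe ?_
        obtain ⟨a, b, rfl, hab, hab'⟩ := exists_lt_of_mem_edgeSet hinj he
        obtain ⟨c, d, rfl, hcd, hcd'⟩ := exists_lt_of_mem_edgeSet hinj hf
        refine eq_parabola_of_mem_inter hab' hcd' ?_ (fun h => hcross _ _ _ _ hab hcd h.1 h.2.1 h.2.2)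
          (fun h => hcross _ _ _ _ hcd hab h.1 h.2.1 h.2.2) hpe hpf
        by_contra! hcon
        exact hne (by simp [hinj hcon.1, hinj hcon.2]) }
  have hU : {p : ℝ × ℝ | p.2 < p.1 ^ 2} ⊆ D.carrierᶜ := by
    rintro p hp (⟨v, rfl⟩ | hpe)
    · exact lt_irrefl (t v ^ 2) hp
    · obtain ⟨⟨e, he⟩, hpe⟩ := Set.mem_iUnion.mp hpe
      obtain ⟨a, b, rfl, -, -⟩ := exists_lt_of_mem_edgeSet hinj he
      exact absurd (sq_le_of_mem_segment_parabola hpe) (not_le.mpr hp)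
  have hx : ((0, -1) : ℝ × ℝ) ∈ {p : ℝ × ℝ | p.2 < p.1 ^ 2} := by simp
  have hUC : {p : ℝ × ℝ | p.2 < p.1 ^ 2} ⊆ connectedComponentIn D.carrierᶜ (0, -1) :=
    isPreconnected_below_parabola.subset_connectedComponentIn hx hU
  refine ⟨D, (0, -1), hU hx, fun hb => ?_, fun v => ?_⟩
  · obtain ⟨C, hC⟩ := isBounded_iff_forall_norm_le.mp (hb.subset hUC)
    have h1 := hC (0, -(|C| + 1)) (by
      simp only [Set.mem_ofPred_eq]
      linarith [abs_nonneg C, sq_nonneg (0 : ℝ)])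
    have h2 := (norm_snd_le ((0, -(|C| + 1)) : ℝ × ℝ)).trans h1
    rw [Real.norm_eq_abs, abs_neg, abs_of_pos (by positivity)] at h2
    linarith [le_abs_self C]
  · refine ⟨closure_mono hUC ?_, fun hint => ?_⟩
    · refine mem_closure_of_tendsto (b := Filter.atTop)
        (f := fun n : ℕ => (t v, t v ^ 2 - 1 / ((n : ℝ) + 1))) ?_ (.of_forall fun n => ?_)
      · refine Filter.Tendsto.prodMk_nhds tendsto_const_nhds ?_
        simpa using tendsto_one_div_add_atTop_nhds_zero_nat.const_sub (t v ^ 2)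
      · have : (0 : ℝ) < 1 / ((n : ℝ) + 1) := by positivity
        simp only [Set.mem_ofPred_eq]
        linarith
    · exact connectedComponentIn_subset _ _ (interior_subset hint) (Or.inl ⟨v, rfl⟩)

/-! ### The corollary -/

theorem exists_isRoyalPetunia_petalGraph_isContained (n : ℕ) (hn : 1 ≤ n) :
    ∃ (V : Type u) (_ : Finite V) (G : SimpleGraph V), IsRoyalPetunia G ∧
      (petalGraph n).IsContained G := by
  let φ := SimpleGraph.Iso.comap (Equiv.ulift.{u} (α := Option (Fin n))) (petalGraph n)
  exact ⟨ULift.{u} (Option (Fin n)), inferInstance, _, .petal _ (φ.symm none) ⟨n, hn, φ.symm, rfl⟩,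
    ⟨⟨φ.symm.toHom, φ.symm.injective⟩⟩⟩

theorem mainTheorem3 (s : ℕ) (hs : 1 ≤ s) :
    -- the value for the class of royal petunias
    classHatGuessingNumber.{u} s (fun _ G => IsRoyalPetunia G)
      = ((4 * s * (s + 1) - 2 : ℕ) : ℕ∞) ∧
    -- a) the upper bound for every royal petunia
    (∀ (V : Type u) (G : SimpleGraph V), IsRoyalPetunia G →
      hatGuessingNumber s G < ((4 * s * (s + 1) - 1 : ℕ) : ℕ∞)) ∧
    -- b) equality for royal petunias that contain a large petal
    (∃ N : ℕ, ∀ n : ℕ, N ≤ n → ∀ (V : Type u) (G : SimpleGraph V), IsRoyalPetunia G →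
      (petalGraph n).IsContained G →
      hatGuessingNumber s G = ((4 * s * (s + 1) - 2 : ℕ) : ℕ∞)) ∧
    -- royal petunias are outerplanar
    (∀ (V : Type u) (G : SimpleGraph V), IsRoyalPetunia G → IsOuterplanar G) ∧
    -- the lower bound for the class of outerplanar graphs
    ((4 * s * (s + 1) - 2 : ℕ) : ℕ∞)
      ≤ classHatGuessingNumber.{u} s (fun _ G => IsOuterplanar G) := by
  obtain ⟨N, hN⟩ := exists_le_hatGuessingNumber.{u} s hs
  obtain ⟨V, hV, G, hG, hGN⟩ :=
    -- `N + 1` rather than `N`, since a petal needs at least one path vertex.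
    exists_isRoyalPetunia_petalGraph_isContained.{u} (N + 1) (by omega)
  have hlow := hN (N + 1) (by omega) V G hGN
  have hpos : 1 ≤ s * (s + 1) := Nat.mul_pos hs s.succ_pos
  refine ⟨le_antisymm (sSup_le ?_) (le_sSup_of_le ⟨V, hV, G, hG, rfl⟩ hlow),
    fun V G hG => (hG.hatGuessingNumber_le hs).trans_lt ?_,
    ⟨N, fun n hn V G hG hGn => le_antisymm (hG.hatGuessingNumber_le hs) (hN n hn V G hGn)⟩,
    fun V G hG => hG.finite_and_hasOnePageEmbedding.2.isOuterplanar,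
    le_sSup_of_le ⟨V, hV, G, hG.finite_and_hasOnePageEmbedding.2.isOuterplanar, rfl⟩ hlow⟩
  · rintro _ ⟨V, -, G, hG, rfl⟩
    exact hG.hatGuessingNumber_le hs
  · rw [Nat.cast_lt, mul_assoc]
    omega
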